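/- Let $k\ge 2$ be an integer and let $G$ be a finite simple undirected graph. Call $G$ *$k$-edge-connected* if deleting fewer than $k$ edges from $G$ always leaves any two vertices connected, and *minimally $k$-edge-connected* if $G$ is $k$-edge-connected but $G\setminus e$ is not $k$-edge-connected for any edge $e$ of $G$. An edge-coloring $\Gamma$ of $G$ (adjacent edges may receive the same color) is an *$MC_k$-coloring* if every two distinct vertices $u,v$ of $G$ are connected by at least $k$ pairwise edge-disjoint $uv$-paths each of which is monochromatic, i.e. all its edges have the same color (different paths may have different colors). Let $mc_k(G)$ denote the maximum number of colors used by an $MC_k$-coloring of $G$. If $G$ is minimally $k$-edge-connected, then $mc_k(G)\le k-1$. -/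

import Mathlib

namespace SimpleGraph

variable {V : Type*} {K : Type*}

/-- `G` is minimally `k`-edge-connected: it is `k`-edge-connected, and deleting any one of its
edges destroys this property (no edge is deletable). -/
def IsMinimallyEdgeConnected (G : SimpleGraph V) (k : ℕ) : Prop :=
  G.IsEdgeConnected k ∧ ∀ e ∈ G.edgeSet, ¬ (G.deleteEdges {e}).IsEdgeConnected k

/-- A walk is monochromatic for an edge-colouring `Γ` if all its edges have the same colour. -/
def Walk.IsMonochromatic {G : SimpleGraph V} (Γ : G.EdgeLabeling K) {u v : V}
    (p : G.Walk u v) : Prop :=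
  ∃ c : K, ∀ (e : Sym2 V) (he : e ∈ p.edges), Γ ⟨e, p.edges_subset_edgeSet he⟩ = c

/-- `Γ` is an `MC_k`-colouring of `G`: every two distinct vertices are connected by at least `k`
pairwise edge-disjoint monochromatic paths (different paths may have different colours). -/
def IsMCColoring {G : SimpleGraph V} (k : ℕ) (Γ : G.EdgeLabeling K) : Prop :=
  ∀ u v : V, u ≠ v → ∃ P : Fin k → G.Path u v,
    (∀ i, (P i : G.Walk u v).IsMonochromatic Γ) ∧
    ∀ i j, i ≠ j → List.Disjoint (P i : G.Walk u v).edges (P j : G.Walk u v).edges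

/-- The numbers `r` such that some `MC_k`-colouring of `G` uses exactly `r` colours. -/
def mcColorCounts (G : SimpleGraph V) (k : ℕ) : Set ℕ :=
  {r | ∃ Γ : G.EdgeLabeling (Fin r), Function.Surjective Γ ∧ IsMCColoring k Γ}

/-- The monochromatic `k`-edge-connection number `mc_k(G)`: the maximum number of colours used
by an `MC_k`-colouring of `G`. -/
noncomputable def mcNumber (G : SimpleGraph V) (k : ℕ) : ℕ :=
  sSup (G.mcColorCounts k)

/-- For a finite graph the set of colour counts is bounded by the number of edges. -/
theorem bddAbove_mcColorCounts [Finite V] (G : SimpleGraph V) (k : ℕ) :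
    BddAbove (G.mcColorCounts k) := by
  refine ⟨Nat.card G.edgeSet, ?_⟩
  rintro r ⟨Γ, hΓ, -⟩
  simpa using Nat.card_le_card_of_surjective Γ hΓ

/-- So `mc_k(G)` is a genuine maximum as soon as `G` has an `MC_k`-colouring at all. -/
theorem isGreatest_mcNumber [Finite V] (G : SimpleGraph V) (k : ℕ)
    (h : (G.mcColorCounts k).Nonempty) : IsGreatest (G.mcColorCounts k) (G.mcNumber k) :=
  ⟨Nat.sSup_mem h (G.bddAbove_mcColorCounts k), fun _ hr =>
    le_csSup (G.bddAbove_mcColorCounts k) hr⟩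

end SimpleGraph

/-!
By minimality every edge `e` lies in a cut of at most `k` edges. The `k` edge-disjoint monochromatic
paths between two vertices separated by this cut use up all of its edges, so the two vertices are
joined in the colour of `e`; hence every colour class is connected and spanning. With `k` or more
colours, all of them occur in each of these cuts, which are therefore rainbow. So every colour class
is a spanning tree, and the cuts are fundamental cuts of all these trees simultaneously, which is
impossible if there are two of them.
-/

namespace MCColoring

open SimpleGraph

variable {V K : Type*} {G H : SimpleGraph V} {X Y : Set V} {k : ℕ} {u v : V} {e : Sym2 V}

/-- The edge cut of `G` determined by `X`: the edges with exactly one end in `X`. They are elements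
of `Sym2 V` rather than of `G.edgeSet`, so that cuts of different graphs on `V` can be compared.
That `X` separates `u` from `v` is written `¬(u ∈ X ↔ v ∈ X)`, without saying which one lies in `X`.
-/
def edgeCut (G : SimpleGraph V) (X : Set V) : Set (Sym2 V) :=
  (G.between X Xᶜ).edgeSet

theorem mk_mem_edgeCut : s(u, v) ∈ edgeCut G X ↔ G.Adj u v ∧ ¬(u ∈ X ↔ v ∈ X) := by
  simp only [edgeCut, mem_edgeSet, between_adj, Set.mem_compl_iff]
  tauto

theorem edgeCut_subset_edgeSet : edgeCut G X ⊆ G.edgeSet :=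
  edgeSet_mono between_le

theorem edgeCut_eq_inter_edgeSet (h : H ≤ G) : edgeCut H X = edgeCut G X ∩ H.edgeSet := by
  ext ⟨a, b⟩
  have hab : H.Adj a b → G.Adj a b := fun hadj => h hadj
  simp only [Set.mem_inter_iff, mk_mem_edgeCut, mem_edgeSet]
  tauto

theorem edgeCut_deleteEdges (s : Set (Sym2 V)) :
    edgeCut (G.deleteEdges s) X = edgeCut G X \ s := by
  ext ⟨a, b⟩
  simp only [Set.mem_sdiff, mk_mem_edgeCut, deleteEdges_adj]
  tauto

theorem exists_mem_edges_mem_edgeCut (p : G.Walk u v) (huv : ¬(u ∈ X ↔ v ∈ X)) :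
    ∃ e ∈ p.edges, e ∈ edgeCut G X := by
  induction p with
  | nil => exact absurd Iff.rfl huv
  | @cons a b c hab q ih =>
    by_cases h : a ∈ X ↔ b ∈ X
    · obtain ⟨e, heq, he⟩ := ih fun hbc => huv (h.trans hbc)
      exact ⟨e, List.mem_cons_of_mem _ heq, he⟩
    · exact ⟨s(a, b), List.mem_cons_self, mk_mem_edgeCut.2 ⟨hab, h⟩⟩

theorem reachable_iff_edgeCut_nonempty :
    G.Reachable u v ↔ ∀ X : Set V, ¬(u ∈ X ↔ v ∈ X) → (edgeCut G X).Nonempty := by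
  refine ⟨fun ⟨p⟩ X huv => ?_, fun h => ?_⟩
  · obtain ⟨e, -, he⟩ := exists_mem_edges_mem_edgeCut p huv
    exact ⟨e, he⟩
  · by_contra huv
    obtain ⟨⟨a, b⟩, hab⟩ := h {w | G.Reachable u w} (by simpa using huv)
    obtain ⟨hadj, hsep⟩ := mk_mem_edgeCut.1 hab
    exact hsep ⟨fun ha => ha.trans hadj.reachable, fun hb => hb.trans hadj.symm.reachable⟩

theorem isEdgeReachable_iff_le_encard_edgeCut :
    G.IsEdgeReachable k u v ↔ ∀ X : Set V, ¬(u ∈ X ↔ v ∈ X) → k ≤ (edgeCut G X).encard := by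
  simp only [IsEdgeReachable, reachable_iff_edgeCut_nonempty, edgeCut_deleteEdges,
    Set.sdiff_nonempty]
  refine ⟨fun h X huv => ?_, fun h s hs X huv hsub => ?_⟩
  · by_contra! hlt
    exact h hlt X huv subset_rfl
  · exact ((h X huv).trans (Set.encard_le_encard hsub)).not_gt hs

theorem exists_mem_edgeCut_encard_le (hG : G.IsMinimallyEdgeConnected k) (he : e ∈ G.edgeSet) :
    ∃ X : Set V, e ∈ edgeCut G X ∧ (edgeCut G X).encard ≤ k := by
  have hdel := hG.2 e he
  simp only [IsEdgeConnected, isEdgeReachable_iff_le_encard_edgeCut, edgeCut_deleteEdges,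
    not_forall, not_le] at hdel
  obtain ⟨u, v, X, huv, hlt⟩ := hdel
  have heX : e ∈ edgeCut G X := by
    by_contra hnot
    rw [Set.sdiff_singleton_eq_self hnot] at hlt
    exact (isEdgeReachable_iff_le_encard_edgeCut.1 (hG.1 u v) X huv).not_gt hlt
  exact ⟨X, heX, Set.encard_sdiff_singleton_add_one heX ▸ Order.add_one_le_of_lt hlt⟩

theorem exists_mem_edges_of_encard_edgeCut_le (P : Fin k → G.Walk u v)
    (hP : ∀ i j, i ≠ j → List.Disjoint (P i).edges (P j).edges) (huv : ¬(u ∈ X ↔ v ∈ X))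
    (hX : (edgeCut G X).encard ≤ k) (he : e ∈ edgeCut G X) : ∃ i, e ∈ (P i).edges := by
  choose f hfP hfX using fun i => exists_mem_edges_mem_edgeCut (P i) huv
  have hf : Function.Injective f := fun i j hij => by
    by_contra hne
    exact hP i j hne (hfP i) (hij ▸ hfP j)
  have hrange : Set.range f = edgeCut G X := by
    refine (Set.finite_of_encard_le_coe hX).eq_of_subset_of_encard_le'
      (Set.range_subset_iff.2 hfX) (hX.trans ?_)
    simp [← Set.image_univ, hf.encard_image]
  obtain ⟨i, rfl⟩ := hrange ▸ he
  exact ⟨i, hfP i⟩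

theorem mem_iff_mem_of_edgeCut_eq_empty (hG : G.Preconnected) (hX : edgeCut G X = ∅) (u v : V) :
    u ∈ X ↔ v ∈ X := by
  by_contra huv
  exact (reachable_iff_edgeCut_nonempty.1 (hG u v) X huv).ne_empty hX

-- The vertices on which `X` and `Y` agree form a set with empty cut in `H`, so `Y` is `X` or `Xᶜ`.
theorem edgeCut_eq_edgeCut_of_preconnected (hH : H.Preconnected)
    (h : edgeCut H X = edgeCut H Y) : edgeCut G X = edgeCut G Y := by
  have hempty : edgeCut H {w | w ∈ X ↔ w ∈ Y} = ∅ := by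
    refine Set.eq_empty_of_forall_notMem fun d hd => ?_
    induction d with | _ a b
    have hXY := Set.ext_iff.1 h s(a, b)
    simp only [mk_mem_edgeCut, Set.mem_ofPred_eq] at hd hXY
    tauto
  ext ⟨a, b⟩
  have hab := mem_iff_mem_of_edgeCut_eq_empty hH hempty a b
  simp only [mk_mem_edgeCut, Set.mem_ofPred_eq] at hab ⊢
  tauto

theorem not_mem_iff_mem_of_isTrail (hX : (edgeCut G X).Subsingleton) (he : e ∈ edgeCut G X)
    {p : G.Walk u v} (hp : p.IsTrail) (hep : e ∈ p.edges) : ¬(u ∈ X ↔ v ∈ X) := by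
  induction p with
  | nil => simp at hep
  | @cons a b c hab q ih =>
    obtain ⟨hq, habq⟩ := (Walk.isTrail_cons _ _).1 hp
    rcases List.mem_cons.1 hep with rfl | heq
    · have hbc : b ∈ X ↔ c ∈ X := by
        by_contra hbc
        obtain ⟨d, hdq, hd⟩ := exists_mem_edges_mem_edgeCut q hbc
        exact habq ((hX hd he : d = s(a, b)) ▸ hdq)
      rw [← hbc]
      exact (mk_mem_edgeCut.1 he).2
    · have hside : a ∈ X ↔ b ∈ X := by
        by_contra hside
        exact habq (hX he (mk_mem_edgeCut.2 ⟨hab, hside⟩) ▸ heq)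
      rw [hside]
      exact ih hq heq

theorem exists_ne_mem_edges_of_not_adj {p : G.Walk u v} (hp : p.IsTrail) (huv : u ≠ v)
    (hadj : ¬G.Adj u v) : ∃ d ∈ p.edges, ∃ d' ∈ p.edges, d ≠ d' := by
  match p with
  | .nil => exact absurd rfl huv
  | .cons h .nil => exact absurd h hadj
  | .cons (v := b) _ (.cons (v := c) _ _) =>
    refine ⟨s(u, b), by simp, s(b, c), by simp, fun heq => ?_⟩
    exact ((Walk.isTrail_cons _ _).1 hp).2 (heq ▸ List.mem_cons_self)

variable {Γ : G.EdgeLabeling K} {c : K}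

theorem mem_edgeCut_labelGraph :
    e ∈ edgeCut (Γ.labelGraph c) X ↔
      ∃ he : e ∈ edgeCut G X, Γ ⟨e, edgeCut_subset_edgeSet he⟩ = c := by
  induction e with | _ a b
  simp only [mk_mem_edgeCut, EdgeLabeling.labelGraph_adj]
  grind

theorem reachable_labelGraph_of_isMonochromatic {p : G.Walk u v} (hp : p.IsMonochromatic Γ)
    {e : G.edgeSet} (he : ↑e ∈ p.edges) : (Γ.labelGraph (Γ e)).Reachable u v := by
  obtain ⟨c, hc⟩ := hp
  refine ⟨p.transfer _ fun d hd => ?_⟩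
  have hde := (hc d hd).trans (hc e he).symm
  induction d with | _ a b
  exact (EdgeLabeling.labelGraph_adj a b).2 ⟨_, hde⟩

theorem preconnected_labelGraph (hG : G.IsMinimallyEdgeConnected k) (hΓ : IsMCColoring k Γ)
    (e : G.edgeSet) : (Γ.labelGraph (Γ e)).Preconnected := by
  obtain ⟨X, he, hX⟩ := exists_mem_edgeCut_encard_le hG e.2
  have across {u v : V} (huv : ¬(u ∈ X ↔ v ∈ X)) : (Γ.labelGraph (Γ e)).Reachable u v := by
    obtain ⟨P, hmono, hdisj⟩ := hΓ u v (fun h => huv (h ▸ Iff.rfl))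
    obtain ⟨i, hi⟩ := exists_mem_edges_of_encard_edgeCut_le _ hdisj huv hX he
    exact reachable_labelGraph_of_isMonochromatic (hmono i) hi
  obtain ⟨⟨a, b⟩, hab⟩ := e
  have hsep : ¬(a ∈ X ↔ b ∈ X) := (mk_mem_edgeCut.1 he).2
  intro u v
  by_cases huv : u ∈ X ↔ v ∈ X
  · obtain ⟨w, hw⟩ : ∃ w, ¬(u ∈ X ↔ w ∈ X) := by
      by_contra! hall
      exact hsep ((hall a).symm.trans (hall b))
    exact (across hw).trans (across fun hvw => hw (huv.trans hvw)).symm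
  · exact across huv

/-- The edge cut determined by `X` is rainbow for the edge-colouring `Γ`: its edges have pairwise
distinct colours, that is, every colour class has at most one edge in it. -/
def IsRainbowCut (Γ : G.EdgeLabeling K) (X : Set V) : Prop :=
  ∀ c, (edgeCut (Γ.labelGraph c) X).Subsingleton

theorem isRainbowCut_of_encard_le (hΓ : ∀ e, (Γ.labelGraph (Γ e)).Preconnected)
    (hfin : (edgeCut G X).Finite) (hX : (edgeCut G X).encard ≤ (Set.range Γ).encard) :
    IsRainbowCut Γ X := by
  intro c d hd d' hd'
  obtain ⟨hdX, rfl⟩ := mem_edgeCut_labelGraph.1 hd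
  obtain ⟨hdX', heq⟩ := mem_edgeCut_labelGraph.1 hd'
  let C : Set G.edgeSet := Subtype.val ⁻¹' edgeCut G X
  have hsurj : Set.range Γ ⊆ Γ '' C := by
    rintro _ ⟨e, rfl⟩
    induction d with | _ a b
    obtain ⟨f, hf⟩ := reachable_iff_edgeCut_nonempty.1 (hΓ e a b) X (mk_mem_edgeCut.1 hdX).2
    obtain ⟨hfX, hfe⟩ := mem_edgeCut_labelGraph.1 hf
    exact ⟨_, hfX, hfe⟩
  have hcard : C.encard ≤ (Γ '' C).encard :=
    calc
      C.encard ≤ (edgeCut G X).encard := Set.encard_preimage_val_le_encard_right _ _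
      _ ≤ (Set.range Γ).encard := hX
      _ ≤ (Γ '' C).encard := Set.encard_le_encard hsurj
  have hinj : Set.InjOn Γ C := (hfin.preimage Subtype.val_injective.injOn).injOn_of_encard_image_eq
    ((Set.encard_image_le _ _).antisymm hcard)
  exact congrArg Subtype.val (hinj hdX hdX' heq.symm)

theorem IsRainbowCut.edgeCut_labelGraph_eq_singleton (hX : IsRainbowCut Γ X) {e : G.edgeSet}
    (he : ↑e ∈ edgeCut G X) : edgeCut (Γ.labelGraph (Γ e)) X = {↑e} :=
  (hX _).eq_singleton_of_mem (mem_edgeCut_labelGraph.2 ⟨he, rfl⟩)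

-- Let `f = xy` have a colour other than `c = Γ e`. The `c`-coloured path from `x` to `y` has two
-- distinct edges; a rainbow cut through either of them separates `x` from `y`, so it contains `f`.
-- As cuts through the only edge `f` of its connected colour class, the two cuts coincide, but then
-- they contain two edges of colour `c`.
theorem subsingleton_range_of_forall_exists_isRainbowCut
    (hΓ : ∀ e, (Γ.labelGraph (Γ e)).Preconnected)
    (hcut : ∀ e ∈ G.edgeSet, ∃ X, e ∈ edgeCut G X ∧ IsRainbowCut Γ X) :
    (Set.range Γ).Subsingleton := by
  rintro _ ⟨e, rfl⟩ _ ⟨⟨⟨x, y⟩, hxy⟩, rfl⟩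
  by_contra hne
  obtain ⟨p, hp⟩ := (hΓ e x y).exists_isPath
  have hnadj : ¬(Γ.labelGraph (Γ e)).Adj x y := fun h =>
    hne ((EdgeLabeling.labelGraph_adj x y).1 h).2.symm
  have hcut_xy {d : Sym2 V} (hd : d ∈ p.edges) : ∃ X, d ∈ edgeCut (Γ.labelGraph (Γ e)) X ∧
      IsRainbowCut Γ X ∧ s(x, y) ∈ edgeCut G X := by
    have hdΓ := p.edges_subset_edgeSet hd
    obtain ⟨X, hdG, hX⟩ := hcut d (edgeSet_mono Γ.labelGraph_le hdΓ)
    have hdX : d ∈ edgeCut (Γ.labelGraph (Γ e)) X := by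
      rw [edgeCut_eq_inter_edgeSet Γ.labelGraph_le]
      exact ⟨hdG, hdΓ⟩
    exact ⟨X, hdX, hX, mk_mem_edgeCut.2
      ⟨hxy, not_mem_iff_mem_of_isTrail (hX _) hdX hp.isTrail hd⟩⟩
  obtain ⟨d, hd, d', hd', hdd'⟩ :=
    exists_ne_mem_edges_of_not_adj hp.isTrail (G.ne_of_adj hxy) hnadj
  obtain ⟨X, hdX, hX, hfX⟩ := hcut_xy hd
  obtain ⟨Y, hdY, hY, hfY⟩ := hcut_xy hd'
  have hXY : edgeCut (Γ.labelGraph (Γ e)) X = edgeCut (Γ.labelGraph (Γ e)) Y := by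
    refine edgeCut_eq_edgeCut_of_preconnected (hΓ ⟨s(x, y), hxy⟩) ?_
    rw [hX.edgeCut_labelGraph_eq_singleton hfX, hY.edgeCut_labelGraph_eq_singleton hfY]
  exact hdd' (hY _ (hXY ▸ hdX) hdY)

end MCColoring

open MCColoring in
theorem theorem2p5_general {V K : Type*} {G : SimpleGraph V} {k : ℕ} (hk : 2 ≤ k)
    (hG : G.IsMinimallyEdgeConnected k) {Γ : G.EdgeLabeling K} (hΓ : SimpleGraph.IsMCColoring k Γ) :
    (Set.range Γ).encard < k := by
  by_contra! hcard
  have hconn := preconnected_labelGraph hG hΓ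
  have hsub : (Set.range Γ).Subsingleton :=
    subsingleton_range_of_forall_exists_isRainbowCut hconn fun e he => by
      obtain ⟨X, heX, hX⟩ := exists_mem_edgeCut_encard_le hG he
      exact ⟨X, heX, isRainbowCut_of_encard_le hconn (Set.finite_of_encard_le_coe hX)
        (hX.trans hcard)⟩
  have hk' : (k : ℕ∞) ≤ 1 := hcard.trans (Set.encard_le_one_iff_subsingleton.2 hsub)
  exact absurd (hk.trans (by exact_mod_cast hk')) (by decide)

theorem theorem2p5 {V : Type*} [Finite V] (G : SimpleGraph V) (k : ℕ) (hk : 2 ≤ k)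
    (hG : G.IsMinimallyEdgeConnected k) : G.mcNumber k ≤ k - 1 := by
  refine csSup_le' fun r ⟨Γ, hsurj, hΓ⟩ => Nat.le_sub_one_of_lt ?_
  simpa [hsurj.range_eq] using theorem2p5_general hk hG hΓ
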